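/- Let $t\ge 0$ be an integer, let $f:\{0,1\}^t\to\{-1,1\}$, and define $F:\{0,1\}^{4t}\times\{0,1\}^{4t}\to\{-1,1\}$, indexing the coordinates of $x,y\in\{0,1\}^{4t}$ by pairs $(i,j)$ with $1\le i\le t$, $1\le j\le 4$, by $$F(x,y)=f\bigl(\dots,\;x_{i,1}y_{i,1}\vee x_{i,2}y_{i,2}\vee x_{i,3}y_{i,3}\vee x_{i,4}y_{i,4},\;\dots\bigr).$$ Then $$Q^*_{1/7}(F)>\tfrac14\deg_{1/3}(f)-3 .$$ Here $\deg_{\epsilon}(f)$ is the least $d$ such that some real polynomial $p$ in $t$ variables of degree at most $d$ satisfies $|f(z)-p(z)|\le\epsilon$ for all $z\in\{0,1\}^t$. For finite sets $X,Y$ and $F:X\times Y\to\{-1,1\}$, $Q^*_\epsilon(F)$ is the least cost of a quantum protocol with prior entanglement that computes $F$ with error $\epsilon$, in the following model. Let $W$ be a finite set with a distinguished element $0$ and let $E$ be a nonempty finite set; both are chosen by the protocol. Let $\mathcal A$, $\mathcal C$, $\mathcal B$ be complex Hilbert spaces with orthonormal bases $\{|x,w,e\rangle\}$, $\{|0\rangle,|1\rangle\}$,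 $\{|y,w,e\rangle\}$ respectively ($x\in X$, $y\in Y$, $w\in W$, $e\in E$). A protocol is a finite sequence of unitary transformations $$U_1\otimes I_{\mathcal B},\quad I_{\mathcal A}\otimes U_2,\quad\dots,\quad U_{2k-1}\otimes I_{\mathcal B},\quad I_{\mathcal A}\otimes U_{2k}\qquad(k\ge 0)$$ of $\mathcal A\otimes\mathcal C\otimes\mathcal B$, where the $U_i$ with $i$ odd are unitary on $\mathcal A\otimes\mathcal C$ and those with $i$ even are unitary on $\mathcal C\otimes\mathcal B$; its cost is $2k$. On input $(x,y)$ these are applied successively to the initial state $|E|^{-1/2}\sum_{e\in E}|x,0,e\rangle|0\rangle|y,0,e\rangle$. If $v$ is the projection of the resulting state onto $\mathcal A\otimes\mathrm{span}(|1\rangle)\otimes\mathcal B$, the protocol outputs $P(x,y)=1$ with probability $\langle v,v\rangle$ and $P(x,y)=0$ otherwise. It computes $F$ with error $\epsilon$ if $\Pr[F(x,y)=(-1)^{P(x,y)}]\ge 1-\epsilon$ for all $x\in X$, $y\in Y$. -/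

import Mathlib

open scoped Kronecker

noncomputable section

/-- The point of `ℝ^t` corresponding to a bit string in `{0,1}^t`. -/
def bitPoint {t : ℕ} (x : Fin t → Bool) : Fin t → ℝ := fun i => if x i then 1 else 0

/-- The `ε`-approximate degree of `f : {0,1}^t → {-1,1}`: the least `d` such that some real
polynomial of (total) degree at most `d` approximates `f` within `ε` at every point of the cube.
The type `ℤˣ` is the two-element set `{-1, 1}`. -/
def approxDegree {t : ℕ} (ε : ℝ) (f : (Fin t → Bool) → ℤˣ) : ℕ :=
  sInf {d : ℕ | ∃ p : MvPolynomial (Fin t) ℝ, p.totalDegree ≤ d ∧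
    ∀ x : Fin t → Bool, |(((f x : ℤˣ) : ℤ) : ℝ) - MvPolynomial.eval (bitPoint x) p| ≤ ε}

/-- A two-party quantum communication protocol with prior entanglement, on the finite input sets
`X` (Alice) and `Y` (Bob). Alice's space has the orthonormal basis `|x, w, e⟩`, Bob's space has the
orthonormal basis `|y, w, e⟩`, and the channel is one qubit, with basis `|0⟩`, `|1⟩`. Here `W` is
the private workspace (with a distinguished element) and `E` the prior entanglement; both are
arbitrary finite sets. A round consists of a unitary transformation of (Alice's space) ⊗ (channel),
followed by a unitary transformation of (channel) ⊗ (Bob's space); these are given by their matrices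
in the bases above and do not depend on the inputs. -/
structure QuantumProtocol (X Y : Type*) [Fintype X] [DecidableEq X] [Fintype Y] [DecidableEq Y] where
  W : Type
  E : Type
  [fintypeW : Fintype W]
  [decidableEqW : DecidableEq W]
  [fintypeE : Fintype E]
  [decidableEqE : DecidableEq E]
  [nonemptyE : Nonempty E]
  w₀ : W
  rounds : List (Matrix.unitaryGroup ((X × W × E) × Fin 2) ℂ ×
    Matrix.unitaryGroup (Fin 2 × (Y × W × E)) ℂ)

namespace QuantumProtocol

attribute [instance] fintypeW decidableEqW fintypeE decidableEqE nonemptyE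

variable {X Y : Type*} [Fintype X] [DecidableEq X] [Fintype Y] [DecidableEq Y]

/-- Vectors of (Alice's space) ⊗ (channel) ⊗ (Bob's space), by their coordinates. -/
abbrev State (P : QuantumProtocol X Y) : Type _ :=
  (X × P.W × P.E) × Fin 2 × (Y × P.W × P.E) → ℂ

/-- The matrix of `U ⊗ I`, for `U` acting on (Alice's space) ⊗ (channel). -/
def aliceMatrix (P : QuantumProtocol X Y)
    (U : Matrix.unitaryGroup ((X × P.W × P.E) × Fin 2) ℂ) :
    Matrix ((X × P.W × P.E) × Fin 2 × (Y × P.W × P.E))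
      ((X × P.W × P.E) × Fin 2 × (Y × P.W × P.E)) ℂ :=
  Matrix.reindex (Equiv.prodAssoc _ _ _) (Equiv.prodAssoc _ _ _)
    ((U : Matrix ((X × P.W × P.E) × Fin 2) ((X × P.W × P.E) × Fin 2) ℂ) ⊗ₖ
      (1 : Matrix (Y × P.W × P.E) (Y × P.W × P.E) ℂ))

/-- The matrix of `I ⊗ U`, for `U` acting on (channel) ⊗ (Bob's space). -/
def bobMatrix (P : QuantumProtocol X Y)
    (U : Matrix.unitaryGroup (Fin 2 × (Y × P.W × P.E)) ℂ) :
    Matrix ((X × P.W × P.E) × Fin 2 × (Y × P.W × P.E))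
      ((X × P.W × P.E) × Fin 2 × (Y × P.W × P.E)) ℂ :=
  (1 : Matrix (X × P.W × P.E) (X × P.W × P.E) ℂ) ⊗ₖ
    (U : Matrix (Fin 2 × (Y × P.W × P.E)) (Fin 2 × (Y × P.W × P.E)) ℂ)

/-- The initial state `|E|^{-1/2} ∑ₑ |x, w₀, e⟩ |0⟩ |y, w₀, e⟩`. -/
def initState (P : QuantumProtocol X Y) (x : X) (y : Y) : P.State :=
  ((1 / Real.sqrt (Fintype.card P.E) : ℝ) : ℂ) •
    ∑ e : P.E, Pi.single ((x, P.w₀, e), 0, (y, P.w₀, e)) 1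

/-- The final state: the rounds are applied successively to the initial state, Alice's
transformation first in each round. -/
def finalState (P : QuantumProtocol X Y) (x : X) (y : Y) : P.State :=
  P.rounds.foldl
    (fun ψ U => (P.bobMatrix U.2).mulVec ((P.aliceMatrix U.1).mulVec ψ)) (P.initState x y)

/-- The number of transformations in the protocol. -/
def cost (P : QuantumProtocol X Y) : ℕ := 2 * P.rounds.length

/-- The squared norm of the projection of the final state onto
(Alice's space) ⊗ span `|1⟩` ⊗ (Bob's space). -/
def acceptProb (P : QuantumProtocol X Y) (x : X) (y : Y) : ℝ :=
  ∑ a : X × P.W × P.E, ∑ b : Y × P.W × P.E, ‖P.finalState x y (a, 1, b)‖ ^ 2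

/-- The probability that the protocol outputs the bit `r` on input `(x, y)`. -/
def outputProb (P : QuantumProtocol X Y) (x : X) (y : Y) (r : Fin 2) : ℝ :=
  if r = 1 then P.acceptProb x y else 1 - P.acceptProb x y

/-- `P` computes `F` with error `ε`: on every input `(x, y)`, the random output bit `r` satisfies
`F (x, y) = (-1) ^ r` with probability at least `1 - ε`. -/
def Computes (P : QuantumProtocol X Y) (F : X → Y → ℤˣ) (ε : ℝ) : Prop :=
  ∀ (x : X) (y : Y),
    1 - ε ≤ ∑ r : Fin 2, if F x y = (-1) ^ (r : ℕ) then P.outputProb x y r else 0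

end QuantumProtocol

/-- `Q*_ε(F)`: the least cost of a quantum protocol with prior entanglement that computes `F`
with error `ε` (and `⊤` if there were none). -/
def quantumCC {X Y : Type*} [Fintype X] [DecidableEq X] [Fintype Y] [DecidableEq Y]
    (ε : ℝ) (F : X → Y → ℤˣ) : ℕ∞ :=
  sInf {c : ℕ∞ | ∃ P : QuantumProtocol X Y, P.Computes F ε ∧ (P.cost : ℕ∞) = c}

/-- The composed function `F(x, y) = f(…, x_{i,1} y_{i,1} ∨ ⋯ ∨ x_{i,4} y_{i,4}, …)` on
`{0,1}^{4t} × {0,1}^{4t}`, the coordinates being indexed by `(i, j)` with `i < t`, `j < 4`. -/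
def blockCompose {t : ℕ} (f : (Fin t → Bool) → ℤˣ) (x y : Fin t × Fin 4 → Bool) : ℤˣ :=
  f fun i => (x (i, 0) && y (i, 0)) || (x (i, 1) && y (i, 1)) ||
    (x (i, 2) && y (i, 2)) || (x (i, 3) && y (i, 3))

end

/-- The character `z ↦ ∏_{i ∈ T} (-1)^{z i}` of the Boolean cube. -/
def boolChar {ι : Type*} (T : Finset ι) (z : ι → Bool) : ℝ :=
  ∏ i ∈ T, if z i then -1 else 1

theorem abs_boolChar {ι : Type*} (T : Finset ι) (z : ι → Bool) : |boolChar T z| = 1 := by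
  unfold boolChar
  rw [Finset.abs_prod]
  refine Finset.prod_eq_one fun i _ => ?_
  split_ifs <;> simp

theorem boolChar_xor {ι : Type*} (T : Finset ι) (z w : ι → Bool) :
    boolChar T (fun i => xor (z i) (w i)) = boolChar T z * boolChar T w := by
  unfold boolChar
  rw [← Finset.prod_mul_distrib]
  have h : ∀ p q : Bool, (if xor p q then (-1 : ℝ) else 1) =
      (if p then -1 else 1) * (if q then -1 else 1) := by
    intro p q
    cases p <;> cases q <;> simp
  exact Finset.prod_congr rfl fun i _ => h _ _

theorem sum_boolChar_mul {ι : Type*} [Fintype ι] [DecidableEq ι] (z w : ι → Bool) :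
    ∑ T : Finset ι, boolChar T z * boolChar T w =
      if z = w then (2 : ℝ) ^ Fintype.card ι else 0 := by
  have h : ∑ T : Finset ι, boolChar T z * boolChar T w =
      ∏ i : ι, (1 + (if z i then (-1 : ℝ) else 1) * (if w i then (-1 : ℝ) else 1)) := by
    rw [Finset.prod_one_add, Finset.powerset_univ]
    exact Finset.sum_congr rfl fun T _ => (Finset.prod_mul_distrib).symm
  rw [h]
  split_ifs with hzw
  · subst hzw
    rw [Finset.prod_congr rfl (g := fun _ => (2 : ℝ))]
    · simp
    · intro i _
      cases z i <;> norm_num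
  · obtain ⟨i, hi⟩ := Function.ne_iff.mp hzw
    refine Finset.prod_eq_zero (Finset.mem_univ i) ?_
    revert hi
    cases z i <;> cases w i <;> simp

theorem sum_norm_sq_boolChar {ι : Type*} [Fintype ι] [DecidableEq ι] (u : (ι → Bool) → ℂ) :
    ∑ T : Finset ι, ‖∑ z, (boolChar T z : ℂ) * u z‖ ^ 2 =
      2 ^ Fintype.card ι * ∑ z, ‖u z‖ ^ 2 := by
  apply Complex.ofReal_injective
  push_cast
  have h (T : Finset ι) : ((‖∑ z, (boolChar T z : ℂ) * u z‖ : ℂ)) ^ 2 =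
      ∑ z, ∑ w, ((boolChar T z * boolChar T w : ℝ) : ℂ) * (u z * (starRingEnd ℂ) (u w)) := by
    rw [← Complex.mul_conj', map_sum, Finset.sum_mul_sum]
    refine Finset.sum_congr rfl fun z _ => Finset.sum_congr rfl fun w _ => ?_
    simp only [map_mul, Complex.conj_ofReal, Complex.ofReal_mul]
    ring
  simp_rw [h]
  rw [Finset.sum_comm, Finset.mul_sum]
  refine Finset.sum_congr rfl fun z _ => ?_
  rw [Finset.sum_comm]
  simp_rw [← Finset.sum_mul, ← Complex.ofReal_sum, sum_boolChar_mul]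
  simp [apply_ite Complex.ofReal, ← Complex.mul_conj']

/-- Fourier inversion on the Boolean cube. -/
theorem boolChar_inversion {ι : Type*} [Fintype ι] [DecidableEq ι] (ψ : (ι → Bool) → ℝ)
    (b : ι → Bool) :
    2 ^ Fintype.card ι * ψ b = ∑ S : Finset ι, (∑ c, ψ c * boolChar S c) * boolChar S b := by
  simp_rw [Finset.sum_mul, mul_assoc]
  rw [Finset.sum_comm]
  simp_rw [← Finset.mul_sum, sum_boolChar_mul]
  simp [mul_comm]

/-- The graph of `V` over `S`. -/
def graphOver {t : ℕ} (S : Finset (Fin t)) (V : Fin t → Bool) : Finset (Fin t × Bool) :=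
  S.map ⟨fun i => (i, V i), fun _ _ h => (Prod.mk.inj h).1⟩

theorem boolChar_graphOver {t : ℕ} (S : Finset (Fin t)) (V : Fin t → Bool)
    (z : Fin t × Bool → Bool) :
    boolChar (graphOver S V) z = boolChar S (fun i => z (i, V i)) := by
  unfold boolChar graphOver
  rw [Finset.prod_map]
  rfl

theorem mem_graphOver {t : ℕ} {S : Finset (Fin t)} {V : Fin t → Bool} {i : Fin t} {b : Bool} :
    (i, b) ∈ graphOver S V ↔ i ∈ S ∧ V i = b := by
  simp only [graphOver, Finset.mem_map]
  constructor
  · rintro ⟨j, hj, h⟩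
    obtain ⟨rfl, rfl⟩ := Prod.mk.inj h
    exact ⟨hj, rfl⟩
  · rintro ⟨hi, rfl⟩
    exact ⟨i, hi, rfl⟩

theorem card_graphOver_fiber_le {t d : ℕ} (T : Finset (Fin t × Bool)) :
    (((Finset.univ : Finset (Finset (Fin t) × (Fin t → Bool))).filter
      fun p => d ≤ p.1.card ∧ graphOver p.1 p.2 = T).card : ℝ) ≤ 2 ^ t / 2 ^ d := by
  by_cases hne : ((Finset.univ : Finset (Finset (Fin t) × (Fin t → Bool))).filter
      fun p => d ≤ p.1.card ∧ graphOver p.1 p.2 = T).Nonempty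
  swap
  · rw [Finset.not_nonempty_iff_eq_empty.mp hne]
    simp only [Finset.card_empty, Nat.cast_zero]
    positivity
  obtain ⟨⟨S, V⟩, hp⟩ := hne
  simp only [Finset.mem_filter, Finset.mem_univ, true_and] at hp
  obtain ⟨hd, rfl⟩ := hp
  have hsub : ((Finset.univ : Finset (Finset (Fin t) × (Fin t → Bool))).filter
      fun p => d ≤ p.1.card ∧ graphOver p.1 p.2 = graphOver S V) ⊆
      {S} ×ˢ Fintype.piFinset (fun i => if i ∈ S then {V i} else Finset.univ) := by
    rintro ⟨S', V'⟩ hp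
    simp only [Finset.mem_filter, Finset.mem_univ, true_and] at hp
    have hmem (i : Fin t) (b : Bool) := congrArg ((i, b) ∈ ·) hp.2
    simp only [mem_graphOver, eq_iff_iff] at hmem
    have hS : S' = S := by
      ext i
      exact ⟨fun h => ((hmem i _).mp ⟨h, rfl⟩).1, fun h => ((hmem i _).mpr ⟨h, rfl⟩).1⟩
    simp only [Finset.mem_product, Finset.mem_singleton, Fintype.mem_piFinset]
    refine ⟨hS, fun i => ?_⟩
    split_ifs with hi
    · exact Finset.mem_singleton.mpr ((hmem i _).mpr ⟨hi, rfl⟩).2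
    · exact Finset.mem_univ _
  have hcard : ((Fintype.piFinset
      (fun i => if i ∈ S then {V i} else (Finset.univ : Finset Bool))).card) = 2 ^ (t - S.card) := by
    rw [Fintype.card_piFinset, ← Finset.prod_mul_prod_compl S, Finset.prod_congr rfl
      (g := fun _ => 1), Finset.prod_congr (s₁ := Sᶜ) rfl (g := fun _ => 2)]
    · simp [Finset.card_compl]
    · intro i hi
      simp [Finset.mem_compl.mp hi]
    · intro i hi
      simp [hi]
  have hle := Finset.card_le_card hsub
  rw [Finset.card_product, Finset.card_singleton, one_mul, hcard] at hle
  have hSt : S.card ≤ t := by simpa using S.card_le_univ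
  rw [le_div_iff₀ (by positivity)]
  have h2 : 2 ^ (t - S.card) * 2 ^ d ≤ 2 ^ t := by
    rw [← pow_add]
    exact Nat.pow_le_pow_right (by norm_num) (by omega)
  exact_mod_cast (Nat.mul_le_mul_right _ hle).trans h2

theorem sum_graphOver_le {t d : ℕ} (g : Finset (Fin t × Bool) → ℝ) (hg : ∀ T, 0 ≤ g T) :
    ∑ S : Finset (Fin t), ∑ V : Fin t → Bool, (if d ≤ S.card then g (graphOver S V) else 0) ≤
      2 ^ t / 2 ^ d * ∑ T, g T := by
  rw [← Fintype.sum_prod_type' (f := fun (S : Finset (Fin t)) (V : Fin t → Bool) =>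
    if d ≤ S.card then g (graphOver S V) else 0), ← Finset.sum_filter,
    ← Finset.sum_fiberwise_of_maps_to (g := fun p : Finset (Fin t) × (Fin t → Bool) =>
      graphOver p.1 p.2) (t := Finset.univ) (fun _ _ => Finset.mem_univ _), Finset.mul_sum]
  refine Finset.sum_le_sum fun T _ => ?_
  rw [Finset.filter_filter, Finset.sum_congr rfl (g := fun _ => g T)]
  · rw [Finset.sum_const, nsmul_eq_mul]
    exact mul_le_mul_of_nonneg_right (card_graphOver_fiber_le T) (hg T)
  · intro p hp
    rw [(Finset.mem_filter.mp hp).2.2]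

/-- A bound on the bilinear form of the pattern matrix of `ψ`. -/
theorem norm_patternMatrix_bilinear_le {t d : ℕ} (ψ : (Fin t → Bool) → ℝ)
    (hψ : ∑ b, |ψ b| ≤ 1)
    (horth : ∀ S : Finset (Fin t), S.card < d → ∑ b, ψ b * boolChar S b = 0)
    (u : (Fin t × Bool → Bool) → ℂ) (v : (Fin t → Bool) → (Fin t → Bool) → ℂ) :
    ‖∑ z, ∑ V, ∑ w, (ψ (fun i => xor (z (i, V i)) (w i)) : ℂ) * (u z * v V w)‖ ≤
      2 ^ t / (2 * √(2 ^ d)) * (∑ z, ‖u z‖ ^ 2 + ∑ V, ∑ w, ‖v V w‖ ^ 2) := by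
  set s : ℝ := √(2 ^ d) with hs
  have hs0 : 0 < s := Real.sqrt_pos.mpr (by positivity)
  have hs2 : s ^ 2 = 2 ^ d := Real.sq_sqrt (by positivity)
  set c : Finset (Fin t) → ℝ := fun S => ∑ b, ψ b * boolChar S b with hc
  have hc1 (S : Finset (Fin t)) : |c S| ≤ 1 := by
    refine (Finset.abs_sum_le_sum_abs _ _).trans (le_trans (le_of_eq ?_) hψ)
    simp [abs_mul, abs_boolChar]
  set U : Finset (Fin t × Bool) → ℂ := fun T => ∑ z, (boolChar T z : ℂ) * u z with hU
  set W : Finset (Fin t) → (Fin t → Bool) → ℂ := fun S V => ∑ w, (boolChar S w : ℂ) * v V w with hW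
  have hexp : (2 : ℂ) ^ t * ∑ z, ∑ V, ∑ w,
      (ψ (fun i => xor (z (i, V i)) (w i)) : ℂ) * (u z * v V w) =
      ∑ S, ∑ V, (c S : ℂ) * (U (graphOver S V) * W S V) := by
    have hpt (z : Fin t × Bool → Bool) (V w : Fin t → Bool) :
        (2 : ℂ) ^ t * (ψ (fun i => xor (z (i, V i)) (w i)) : ℂ) =
        ∑ S, (c S : ℂ) * ((boolChar (graphOver S V) z : ℂ) * (boolChar S w : ℂ)) := by
      have h := boolChar_inversion ψ (fun i => xor (z (i, V i)) (w i))
      simp_rw [boolChar_xor, ← boolChar_graphOver, Fintype.card_fin] at h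
      exact_mod_cast congrArg Complex.ofReal h
    simp_rw [hU, hW, Finset.sum_mul_sum, Finset.mul_sum, ← mul_assoc, hpt, Finset.sum_mul]
    rw [Finset.sum_comm' (t' := Finset.univ) (s' := fun _ => Finset.univ) (by simp)]
    rw [Finset.sum_comm (γ := Finset (Fin t))]
    refine Finset.sum_congr rfl fun V _ => ?_
    rw [Finset.sum_comm' (s := (Finset.univ : Finset (Finset (Fin t)))) (t' := Finset.univ)
      (s' := fun _ => Finset.univ) (by simp)]
    refine Finset.sum_congr rfl fun z _ => ?_
    rw [Finset.sum_comm]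
    refine Finset.sum_congr rfl fun S _ => Finset.sum_congr rfl fun w _ => ?_
    ring
  have hUsum : ∑ T, ‖U T‖ ^ 2 = 2 ^ (2 * t) * ∑ z, ‖u z‖ ^ 2 := by
    rw [hU, sum_norm_sq_boolChar]
    simp [mul_comm]
  have hWsum : ∑ S, ∑ V, ‖W S V‖ ^ 2 = 2 ^ t * ∑ V, ∑ w, ‖v V w‖ ^ 2 := by
    rw [Finset.sum_comm, Finset.mul_sum]
    refine Finset.sum_congr rfl fun V _ => ?_
    rw [hW, sum_norm_sq_boolChar]
    simp
  have hterm (S : Finset (Fin t)) (V : Fin t → Bool) :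
      ‖(c S : ℂ) * (U (graphOver S V) * W S V)‖ ≤
      s / (2 * 2 ^ t) * (if d ≤ S.card then ‖U (graphOver S V)‖ ^ 2 else 0) +
        2 ^ t / (2 * s) * ‖W S V‖ ^ 2 := by
    split_ifs with hd
    · rw [norm_mul, norm_mul, Complex.norm_real, Real.norm_eq_abs]
      set p := ‖U (graphOver S V)‖
      set q := ‖W S V‖
      have hp : 0 ≤ p := norm_nonneg _
      have hq : 0 ≤ q := norm_nonneg _
      have h1 : |c S| * (p * q) ≤ p * q := mul_le_of_le_one_left (by positivity) (hc1 S)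
      refine h1.trans ?_
      have h2 : (0 : ℝ) ≤ (s * p - 2 ^ t * q) ^ 2 / (2 * s * 2 ^ t) := by positivity
      have h3 : (s * p - 2 ^ t * q) ^ 2 / (2 * s * 2 ^ t) =
          s / (2 * 2 ^ t) * p ^ 2 + 2 ^ t / (2 * s) * q ^ 2 - p * q := by
        field_simp
        ring
      linarith
    · have h0 : c S = 0 := horth S (by omega)
      rw [h0]
      simp only [Complex.ofReal_zero, zero_mul, norm_zero]
      positivity
  have hsum : ‖(2 : ℂ) ^ t * ∑ z, ∑ V, ∑ w,
      (ψ (fun i => xor (z (i, V i)) (w i)) : ℂ) * (u z * v V w)‖ ≤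
      s / (2 * 2 ^ t) * (2 ^ t / 2 ^ d * (2 ^ (2 * t) * ∑ z, ‖u z‖ ^ 2)) +
        2 ^ t / (2 * s) * (2 ^ t * ∑ V, ∑ w, ‖v V w‖ ^ 2) := by
    rw [hexp, ← hUsum, ← hWsum]
    calc _ ≤ ∑ S, ∑ V, ‖(c S : ℂ) * (U (graphOver S V) * W S V)‖ :=
          (norm_sum_le _ _).trans (Finset.sum_le_sum fun S _ => norm_sum_le _ _)
      _ ≤ _ := Finset.sum_le_sum fun S _ => Finset.sum_le_sum fun V _ => hterm S V
      _ = s / (2 * 2 ^ t) * (∑ S : Finset (Fin t), ∑ V : Fin t → Bool,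
            if d ≤ S.card then ‖U (graphOver S V)‖ ^ 2 else 0) +
            2 ^ t / (2 * s) * ∑ S, ∑ V, ‖W S V‖ ^ 2 := by
          simp_rw [Finset.sum_add_distrib, Finset.mul_sum]
      _ ≤ _ := by
          gcongr
          exact sum_graphOver_le (fun T => ‖U T‖ ^ 2) fun T => by positivity
  rw [norm_mul, norm_pow, Complex.norm_ofNat] at hsum
  have h2t : (0 : ℝ) < 2 ^ t := by positivity
  refine le_of_mul_le_mul_left (hsum.trans (le_of_eq ?_)) h2t
  rw [← hs2]
  field_simp
  ring

open scoped Matrix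

section Contractions

open scoped Matrix.Norms.L2Operator

theorem Matrix.l2_opNorm_one_le {n : Type*} [Fintype n] [DecidableEq n] :
    ‖(1 : Matrix n n ℂ)‖ ≤ 1 := by
  have h : ‖(1 : Matrix n n ℂ)‖ = ‖(1 : Matrix n n ℂ)‖ * ‖(1 : Matrix n n ℂ)‖ := by
    simpa using Matrix.l2_opNorm_conjTranspose_mul_self (1 : Matrix n n ℂ)
  nlinarith [norm_nonneg (1 : Matrix n n ℂ)]

theorem Matrix.l2_opNorm_le_one_of_conjTranspose_mul_self {m n : Type*} [Fintype m] [Fintype n]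
    [DecidableEq n] {A : Matrix m n ℂ} (h : Aᴴ * A = 1) : ‖A‖ ≤ 1 := by
  have h1 := Matrix.l2_opNorm_conjTranspose_mul_self A
  rw [h] at h1
  have h2 := Matrix.l2_opNorm_one_le (n := n)
  nlinarith [norm_nonneg A]

theorem Matrix.l2_opNorm_unitary_le_one {n : Type*} [Fintype n] [DecidableEq n]
    (U : Matrix.unitaryGroup n ℂ) : ‖(U : Matrix n n ℂ)‖ ≤ 1 :=
  Matrix.l2_opNorm_le_one_of_conjTranspose_mul_self (Matrix.mem_unitaryGroup_iff'.mp U.2)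

theorem Matrix.l2_opNorm_one_submatrix_right_le {m m' : Type*} [Fintype m] [Fintype m']
    [DecidableEq m] [DecidableEq m'] {f : m' → m} (hf : f.Injective) :
    ‖(1 : Matrix m m ℂ).submatrix id f‖ ≤ 1 := by
  apply Matrix.l2_opNorm_le_one_of_conjTranspose_mul_self
  ext i j
  simp [Matrix.mul_apply, Matrix.one_apply, hf.eq_iff, eq_comm]

theorem Matrix.l2_opNorm_one_submatrix_left_le {m m' : Type*} [Fintype m] [Fintype m']
    [DecidableEq m] [DecidableEq m'] {f : m' → m} (hf : f.Injective) :
    ‖(1 : Matrix m m ℂ).submatrix f id‖ ≤ 1 := by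
  rw [← Matrix.l2_opNorm_conjTranspose]
  simpa using Matrix.l2_opNorm_one_submatrix_right_le hf

theorem Matrix.l2_opNorm_submatrix_le {m n m' n' : Type*} [Fintype m] [Fintype n] [Fintype m']
    [Fintype n'] [DecidableEq m] [DecidableEq n] [DecidableEq m'] [DecidableEq n']
    (A : Matrix m n ℂ) {f : m' → m} {g : n' → n} (hf : f.Injective) (hg : g.Injective) :
    ‖A.submatrix f g‖ ≤ ‖A‖ := by
  have h : A.submatrix f g =
      (1 : Matrix m m ℂ).submatrix f id * A * (1 : Matrix n n ℂ).submatrix id g := by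
    ext i j
    simp [Matrix.mul_apply, Matrix.one_apply]
  rw [h]
  calc _ ≤ ‖(1 : Matrix m m ℂ).submatrix f id * A‖ * ‖(1 : Matrix n n ℂ).submatrix id g‖ :=
        Matrix.l2_opNorm_mul _ _
    _ ≤ ‖(1 : Matrix m m ℂ).submatrix f id * A‖ :=
        mul_le_of_le_one_right (norm_nonneg _) (Matrix.l2_opNorm_one_submatrix_right_le hg)
    _ ≤ ‖(1 : Matrix m m ℂ).submatrix f id‖ * ‖A‖ := Matrix.l2_opNorm_mul _ _
    _ ≤ ‖A‖ := mul_le_of_le_one_left (norm_nonneg _) 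
          (Matrix.l2_opNorm_one_submatrix_left_le hf)

theorem Matrix.sum_norm_sq_mulVec_le {m n : Type*} [Fintype m] [Fintype n] [DecidableEq n]
    {A : Matrix m n ℂ} (hA : ‖A‖ ≤ 1) (v : n → ℂ) :
    ∑ i, ‖(A.mulVec v) i‖ ^ 2 ≤ ∑ j, ‖v j‖ ^ 2 := by
  have h := (Matrix.l2_opNorm_mulVec A (WithLp.toLp 2 v)).trans
    (mul_le_of_le_one_left (norm_nonneg _) hA)
  have h2 := pow_le_pow_left₀ (norm_nonneg _) h 2
  simpa [EuclideanSpace.norm_sq_eq] using h2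

theorem Matrix.sum_norm_sq_col_le {m n : Type*} [Fintype m] [Fintype n] [DecidableEq n]
    {A : Matrix m n ℂ} (hA : ‖A‖ ≤ 1) (j : n) : ∑ i, ‖A i j‖ ^ 2 ≤ 1 := by
  refine (le_of_eq ?_).trans ((Matrix.sum_norm_sq_mulVec_le hA (Pi.single j 1)).trans
    (le_of_eq ?_))
  · simp
  · rw [Finset.sum_eq_single j] <;> simp +contextual

/-- A bound on the Gram entries of a family of contractions, over a set of basis vectors. -/
theorem sum_norm_sq_gram_le {α E ι : Type*} [Fintype α] [DecidableEq α] [Fintype E] [Fintype ι]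
    (A : ι → Matrix α α ℂ) (hA : ∀ i, ‖A i‖ ≤ 1) {φ : E → α} (hφ : φ.Injective) :
    ∑ p : ι × E, ∑ q : ι × E, ‖((A p.1)ᴴ * A q.1) (φ p.2) (φ q.2)‖ ^ 2 ≤
      (Fintype.card ι : ℝ) ^ 2 * Fintype.card E := by
  have h (i j : ι) : ‖(A i)ᴴ * A j‖ ≤ 1 := by
    refine (Matrix.l2_opNorm_mul _ _).trans ?_
    rw [Matrix.l2_opNorm_conjTranspose]
    exact mul_le_one₀ (hA i) (norm_nonneg _) (hA j)
  have h2 (i j : ι) (e : E) : ∑ e', ‖((A i)ᴴ * A j) (φ e') (φ e)‖ ^ 2 ≤ 1 := by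
    refine le_trans ?_ (Matrix.sum_norm_sq_col_le (h i j) (φ e))
    rw [← Finset.sum_image (s := Finset.univ) (g := φ)
      (f := fun a => ‖((A i)ᴴ * A j) a (φ e)‖ ^ 2) (fun _ _ _ _ h => hφ h)]
    exact Finset.sum_le_sum_of_subset_of_nonneg (Finset.subset_univ _)
      fun _ _ _ => by positivity
  rw [Finset.sum_comm]
  calc _ = ∑ q : ι × E, ∑ i, ∑ e', ‖((A i)ᴴ * A q.1) (φ e') (φ q.2)‖ ^ 2 :=
        Finset.sum_congr rfl fun q _ => Fintype.sum_prod_type _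
    _ ≤ ∑ _q : ι × E, ∑ _i : ι, (1 : ℝ) :=
        Finset.sum_le_sum fun q _ => Finset.sum_le_sum fun i _ => h2 i q.1 q.2
    _ = _ := by
        simp
        ring

/-- The squared norm of a sum of product vectors, expanded into Gram entries. -/
theorem sum_norm_sq_sum_mul {α β κ : Type*} [Fintype α] [Fintype β] [Fintype κ] (r : ℝ)
    (G : Matrix α κ ℂ) (H : Matrix β κ ℂ) :
    ((∑ a, ∑ b, ‖(r : ℂ) * ∑ q, G a q * H b q‖ ^ 2 : ℝ) : ℂ) =
      ∑ p, ∑ q, ((r : ℂ) * (Gᴴ * G) p q) * ((r : ℂ) * (Hᴴ * H) p q) := by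
  have h (a : α) (b : β) : ((‖(r : ℂ) * ∑ q, G a q * H b q‖ ^ 2 : ℝ) : ℂ) =
      ∑ p, ∑ q, (r : ℂ) ^ 2 * ((star (G a p) * G a q) * (star (H b p) * H b q)) := by
    rw [Complex.ofReal_pow, ← Complex.conj_mul', map_mul, Complex.conj_ofReal, map_sum,
      mul_mul_mul_comm, Finset.sum_mul_sum, Finset.mul_sum]
    refine Finset.sum_congr rfl fun p _ => ?_
    rw [Finset.mul_sum]
    refine Finset.sum_congr rfl fun q _ => ?_
    simp only [map_mul, Complex.star_def]
    ring
  simp only [Complex.ofReal_sum, h]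
  have hr (p q : κ) : ((r : ℂ) * (Gᴴ * G) p q) * ((r : ℂ) * (Hᴴ * H) p q) =
      ∑ a, ∑ b, (r : ℂ) ^ 2 * ((star (G a p) * G a q) * (star (H b p) * H b q)) := by
    rw [mul_mul_mul_comm, Matrix.mul_apply, Matrix.mul_apply, Finset.sum_mul_sum, Finset.mul_sum]
    refine Finset.sum_congr rfl fun a _ => ?_
    rw [Finset.mul_sum]
    refine Finset.sum_congr rfl fun b _ => ?_
    simp only [Matrix.conjTranspose_apply]
    ring
  simp only [hr]
  rw [← Fintype.sum_prod_type' (f := fun a b => ∑ p, ∑ q,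
      (r : ℂ) ^ 2 * ((star (G a p) * G a q) * (star (H b p) * H b q))), Finset.sum_comm]
  refine Finset.sum_congr rfl fun p _ => ?_
  rw [Finset.sum_comm]
  exact Finset.sum_congr rfl fun q _ => Fintype.sum_prod_type _

theorem sum_alice_step {α γ ε ι : Type*} [Fintype α] [Fintype γ] [Fintype ε] [Fintype ι] (r : ℂ)
    (u : α → γ → ℂ) (A : γ → ι → α → ε → ℂ) (B : γ → ι → ε → ℂ) :
    ∑ a, ∑ c, u a c * (r * ∑ e, ∑ i, A c i a e * B c i e) =
      r * ∑ e, ∑ c, ∑ i, (∑ a, u a c * A c i a e) * B c i e := by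
  simp only [Finset.mul_sum, Finset.sum_mul]
  rw [Finset.sum_comm]
  conv_rhs => rw [Finset.sum_comm]
  refine Finset.sum_congr rfl fun c _ => ?_
  rw [Finset.sum_comm]
  refine Finset.sum_congr rfl fun e _ => ?_
  rw [Finset.sum_comm]
  exact Finset.sum_congr rfl fun i _ => Finset.sum_congr rfl fun a _ => by ring

theorem sum_bob_step {β γ δ ε ι : Type*} [Fintype β] [Fintype γ] [Fintype δ] [Fintype ε]
    [Fintype ι] (r : ℂ) (u : γ → β → ℂ) (A : γ → δ → ι → ε → ℂ) (B : δ → ι → β → ε → ℂ) :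
    ∑ c, ∑ b, u c b * (r * ∑ e, ∑ d, ∑ i, A c d i e * B d i b e) =
      r * ∑ e, ∑ c, ∑ d, ∑ i, A c d i e * (∑ b, u c b * B d i b e) := by
  simp only [Finset.mul_sum]
  conv_rhs => rw [Finset.sum_comm]
  refine Finset.sum_congr rfl fun c _ => ?_
  rw [Finset.sum_comm]
  refine Finset.sum_congr rfl fun e _ => ?_
  rw [Finset.sum_comm]
  refine Finset.sum_congr rfl fun d _ => ?_
  rw [Finset.sum_comm]
  exact Finset.sum_congr rfl fun i _ => Finset.sum_congr rfl fun b _ => by ring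

end Contractions

namespace QuantumProtocol

open scoped Matrix.Norms.L2Operator

variable {X Y : Type*} [Fintype X] [DecidableEq X] [Fintype Y] [DecidableEq Y]

theorem aliceMatrix_conjTranspose_mul_self (P : QuantumProtocol X Y)
    (U : Matrix.unitaryGroup ((X × P.W × P.E) × Fin 2) ℂ) :
    (P.aliceMatrix U)ᴴ * P.aliceMatrix U = 1 := by
  unfold aliceMatrix
  rw [Matrix.conjTranspose_reindex, Matrix.conjTranspose_kronecker]
  simp only [Matrix.reindex_apply, Matrix.submatrix_mul_equiv]
  rw [← Matrix.mul_kronecker_mul, ← Matrix.star_eq_conjTranspose,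
    Matrix.mem_unitaryGroup_iff'.mp U.2]
  simp

theorem bobMatrix_conjTranspose_mul_self (P : QuantumProtocol X Y)
    (U : Matrix.unitaryGroup (Fin 2 × (Y × P.W × P.E)) ℂ) :
    (P.bobMatrix U)ᴴ * P.bobMatrix U = 1 := by
  unfold bobMatrix
  have hU := Matrix.mem_unitaryGroup_iff'.mp U.2
  rw [Matrix.star_eq_conjTranspose] at hU
  rw [Matrix.conjTranspose_kronecker, ← Matrix.mul_kronecker_mul, hU]
  simp

theorem initState_apply (P : QuantumProtocol X Y) (x : X) (y : Y) (a : X × P.W × P.E)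
    (c : Fin 2) (b : Y × P.W × P.E) :
    P.initState x y (a, c, b) = ((1 / √(Fintype.card P.E) : ℝ) : ℂ) * ∑ e : P.E,
      (if a = (x, P.w₀, e) then 1 else 0) * (if c = 0 then 1 else 0) *
        (if b = (y, P.w₀, e) then 1 else 0) := by
  simp only [initState, Pi.smul_apply, smul_eq_mul, Finset.sum_apply, Pi.single_apply,
    Prod.mk.injEq, ite_and, mul_ite, mul_one, mul_zero]
  congr 1
  refine Finset.sum_congr rfl fun e _ => ?_
  split_ifs <;> simp_all

theorem sum_norm_sq_initState (P : QuantumProtocol X Y) (x : X) (y : Y) :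
    ∑ s, ‖P.initState x y s‖ ^ 2 = 1 := by
  have hE : (0 : ℝ) < Fintype.card P.E := by exact_mod_cast Fintype.card_pos
  have h (s : (X × P.W × P.E) × Fin 2 × (Y × P.W × P.E)) : ‖P.initState x y s‖ ^ 2 =
      1 / Fintype.card P.E * ∑ e : P.E,
        if s = ((x, P.w₀, e), 0, (y, P.w₀, e)) then 1 else 0 := by
    simp only [initState, Pi.smul_apply, smul_eq_mul, norm_mul, mul_pow, Complex.norm_real,
      Finset.sum_apply, Pi.single_apply]
    congr 1
    · rw [Real.norm_eq_abs, sq_abs, div_pow, one_pow, Real.sq_sqrt hE.le]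
    · by_cases hs : ∃ e, s = ((x, P.w₀, e), 0, (y, P.w₀, e))
      · obtain ⟨e, rfl⟩ := hs
        simp
      · push Not at hs
        simp [hs]
  simp_rw [h, ← Finset.mul_sum]
  rw [Finset.sum_comm]
  simp [hE.ne']

theorem sum_norm_sq_finalState_le_one (P : QuantumProtocol X Y) (x : X) (y : Y) :
    ∑ s, ‖P.finalState x y s‖ ^ 2 ≤ 1 := by
  have key (l : List (Matrix.unitaryGroup ((X × P.W × P.E) × Fin 2) ℂ ×
      Matrix.unitaryGroup (Fin 2 × (Y × P.W × P.E)) ℂ)) (v : P.State) :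
      ∑ s, ‖l.foldl (fun ψ U => (P.bobMatrix U.2).mulVec ((P.aliceMatrix U.1).mulVec ψ)) v s‖ ^ 2
        ≤ ∑ s, ‖v s‖ ^ 2 := by
    induction l generalizing v with
    | nil => rfl
    | cons U l ih =>
      refine (ih _).trans ((Matrix.sum_norm_sq_mulVec_le ?_ _).trans
        (Matrix.sum_norm_sq_mulVec_le ?_ _))
      · exact Matrix.l2_opNorm_le_one_of_conjTranspose_mul_self
          (P.bobMatrix_conjTranspose_mul_self U.2)
      · exact Matrix.l2_opNorm_le_one_of_conjTranspose_mul_self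
          (P.aliceMatrix_conjTranspose_mul_self U.1)
  exact (key _ _).trans (P.sum_norm_sq_initState x y).le

theorem acceptProb_nonneg (P : QuantumProtocol X Y) (x : X) (y : Y) : 0 ≤ P.acceptProb x y :=
  Finset.sum_nonneg fun _ _ => Finset.sum_nonneg fun _ _ => by positivity

theorem acceptProb_le_one (P : QuantumProtocol X Y) (x : X) (y : Y) : P.acceptProb x y ≤ 1 := by
  refine le_trans ?_ (P.sum_norm_sq_finalState_le_one x y)
  rw [Fintype.sum_prod_type]
  refine Finset.sum_le_sum fun a _ => ?_
  rw [Fintype.sum_prod_type (f := fun s => ‖P.finalState x y (a, s)‖ ^ 2), Fin.sum_univ_two]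
  exact le_add_of_nonneg_left (Finset.sum_nonneg fun _ _ => by positivity)

theorem aliceMatrix_mulVec (P : QuantumProtocol X Y)
    (U : Matrix.unitaryGroup ((X × P.W × P.E) × Fin 2) ℂ) (v : P.State) (a : X × P.W × P.E)
    (c : Fin 2) (b : Y × P.W × P.E) :
    (P.aliceMatrix U).mulVec v (a, c, b) =
      ∑ a', ∑ c', (U : Matrix _ _ ℂ) (a, c) (a', c') * v (a', c', b) := by
  simp [aliceMatrix, Matrix.mulVec, dotProduct, Fintype.sum_prod_type, Matrix.one_apply]

theorem bobMatrix_mulVec (P : QuantumProtocol X Y)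
    (U : Matrix.unitaryGroup (Fin 2 × (Y × P.W × P.E)) ℂ) (v : P.State) (a : X × P.W × P.E)
    (c : Fin 2) (b : Y × P.W × P.E) :
    (P.bobMatrix U).mulVec v (a, c, b) =
      ∑ c', ∑ b', (U : Matrix _ _ ℂ) (c, b) (c', b') * v (a, c', b') := by
  simp only [bobMatrix, Matrix.mulVec, dotProduct]
  rw [Fintype.sum_prod_type, Finset.sum_eq_single a]
  · simp [Fintype.sum_prod_type]
  · intro a' _ ha
    simp [ha.symm]
  · simp

/-- The state is a sum of products of contractions on the two sides, one for each transcript. -/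
theorem exists_transcript_decomposition (P : QuantumProtocol X Y) :
    ∃ (ι : Type) (_ : Fintype ι) (A : Fin 2 → ι → Matrix (X × P.W × P.E) (X × P.W × P.E) ℂ)
      (B : Fin 2 → ι → Matrix (Y × P.W × P.E) (Y × P.W × P.E) ℂ),
      Fintype.card ι = 4 ^ P.rounds.length ∧ (∀ c i, ‖A c i‖ ≤ 1) ∧ (∀ c i, ‖B c i‖ ≤ 1) ∧
      ∀ x y a c b, P.finalState x y (a, c, b) = ((1 / √(Fintype.card P.E) : ℝ) : ℂ) *
        ∑ e : P.E, ∑ i : ι, A c i a (x, P.w₀, e) * B c i b (y, P.w₀, e) := by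
  unfold finalState
  induction P.rounds using List.reverseRecOn with
  | nil =>
    refine ⟨Unit, inferInstance, fun c _ => if c = 0 then 1 else 0, fun _ _ => 1, by simp, ?_,
      fun _ _ => Matrix.l2_opNorm_one_le, ?_⟩
    · intro c _
      dsimp only
      split_ifs
      · exact Matrix.l2_opNorm_one_le
      · simp
    · intro x y a c b
      rw [List.foldl_nil, initState_apply]
      congr 1
      refine Finset.sum_congr rfl fun e _ => ?_
      split_ifs <;> simp_all [Matrix.one_apply]
  | append_singleton l U ih =>
    obtain ⟨ι, _, A, B, hcard, hA, hB, h⟩ := ih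
    refine ⟨Fin 2 × Fin 2 × ι, inferInstance,
      fun _ p => (U.1 : Matrix _ _ ℂ).submatrix (fun a => (a, p.1)) (fun a => (a, p.2.1)) *
        A p.2.1 p.2.2,
      fun c p => (U.2 : Matrix _ _ ℂ).submatrix (fun b => (c, b)) (fun b => (p.1, b)) *
        B p.2.1 p.2.2, ?_, ?_, ?_, ?_⟩
    · simp only [Fintype.card_prod, Fintype.card_fin, hcard, List.length_append,
        List.length_singleton]
      ring
    · intro c p
      refine (Matrix.l2_opNorm_mul _ _).trans (mul_le_one₀ ?_ (norm_nonneg _) (hA _ _))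
      exact (Matrix.l2_opNorm_submatrix_le _ (Prod.mk_left_injective _)
        (Prod.mk_left_injective _)).trans (Matrix.l2_opNorm_unitary_le_one _)
    · intro c p
      refine (Matrix.l2_opNorm_mul _ _).trans (mul_le_one₀ ?_ (norm_nonneg _) (hB _ _))
      exact (Matrix.l2_opNorm_submatrix_le _ (Prod.mk_right_injective _)
        (Prod.mk_right_injective _)).trans (Matrix.l2_opNorm_unitary_le_one _)
    · intro x y a c b
      simp only [List.foldl_append, List.foldl_cons, List.foldl_nil]
      rw [bobMatrix_mulVec]
      simp_rw [aliceMatrix_mulVec, h]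
      simp_rw [sum_alice_step]
      rw [sum_bob_step]
      simp only [Matrix.mul_apply, Matrix.submatrix_apply, Fintype.sum_prod_type]

theorem sum_norm_sq_scaled_gram_le (P : QuantumProtocol X Y) {Z ι : Type*} [Fintype Z]
    [DecidableEq Z] [Fintype ι] (M : ι → Matrix (Z × P.W × P.E) (Z × P.W × P.E) ℂ)
    (hM : ∀ i, ‖M i‖ ≤ 1) {k : ℕ} (hk : Fintype.card ι = 4 ^ k) (z : Z) :
    ∑ p : (ι × P.E) × (ι × P.E), ‖((1 / √(Fintype.card P.E) : ℝ) : ℂ) *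
      ((M p.1.1)ᴴ * M p.2.1) (z, P.w₀, p.1.2) (z, P.w₀, p.2.2)‖ ^ 2 ≤ 16 ^ k := by
  have hE : (0 : ℝ) < Fintype.card P.E := by exact_mod_cast Fintype.card_pos
  simp only [norm_mul, mul_pow, ← Finset.mul_sum, Complex.norm_real,
    Real.norm_eq_abs, sq_abs]
  rw [div_pow, one_pow, Real.sq_sqrt hE.le, Fintype.sum_prod_type]
  have h1 := sum_norm_sq_gram_le M hM (φ := fun e => (z, P.w₀, e)) (fun _ _ h => by simpa using h)
  rw [hk, Nat.cast_pow, ← pow_mul, mul_comm _ 2, pow_mul] at h1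
  rw [one_div_mul_eq_div, div_le_iff₀ hE]
  refine h1.trans (le_of_eq ?_)
  norm_num

theorem exists_acceptProb_factorization (P : QuantumProtocol X Y) :
    ∃ (κ : Type) (_ : Fintype κ) (A : X → κ → ℂ) (B : Y → κ → ℂ),
      (∀ x y, (P.acceptProb x y : ℂ) = ∑ p, A x p * B y p) ∧
      (∀ x, ∑ p, ‖A x p‖ ^ 2 ≤ 16 ^ P.rounds.length) ∧
      (∀ y, ∑ p, ‖B y p‖ ^ 2 ≤ 16 ^ P.rounds.length) := by
  obtain ⟨ι, _, A, B, hcard, hA, hB, h⟩ := P.exists_transcript_decomposition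
  set r : ℝ := 1 / √(Fintype.card P.E)
  refine ⟨(ι × P.E) × (ι × P.E), inferInstance,
    fun x p => (r : ℂ) * ((A 1 p.1.1)ᴴ * A 1 p.2.1) (x, P.w₀, p.1.2) (x, P.w₀, p.2.2),
    fun y p => (r : ℂ) * ((B 1 p.1.1)ᴴ * B 1 p.2.1) (y, P.w₀, p.1.2) (y, P.w₀, p.2.2),
    fun x y => ?_, fun x => P.sum_norm_sq_scaled_gram_le _ (hA 1) hcard x,
    fun y => P.sum_norm_sq_scaled_gram_le _ (hB 1) hcard y⟩
  have hprod (a : X × P.W × P.E) (b : Y × P.W × P.E) :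
      ∑ e : P.E, ∑ i : ι, A 1 i a (x, P.w₀, e) * B 1 i b (y, P.w₀, e) =
      ∑ q : ι × P.E, A 1 q.1 a (x, P.w₀, q.2) * B 1 q.1 b (y, P.w₀, q.2) := by
    rw [Finset.sum_comm, Fintype.sum_prod_type]
  simp only [acceptProb, h, hprod]
  rw [sum_norm_sq_sum_mul r (fun a (q : ι × P.E) => A 1 q.1 a (x, P.w₀, q.2))
    (fun b (q : ι × P.E) => B 1 q.1 b (y, P.w₀, q.2))]
  conv_rhs => rw [Fintype.sum_prod_type]
  rfl

end QuantumProtocol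

/-- Duality for uniform approximation by a subspace on a finite set. -/
theorem exists_annihilating_functional {β : Type*} [Fintype β] [DecidableEq β]
    (W : Submodule ℝ (β → ℝ)) (f : β → ℝ) {ε : ℝ} (hf : ∀ w ∈ W, ε ≤ ‖f - w‖) :
    ∃ ψ : β → ℝ, ∑ b, |ψ b| ≤ 1 ∧ (∀ w ∈ W, ∑ b, ψ b * w b = 0) ∧ ε ≤ ∑ b, ψ b * f b := by
  obtain ⟨g, hg1, hgf⟩ := exists_dual_vector'' ℝ (Submodule.Quotient.mk f : (β → ℝ) ⧸ W)
  have hlin (w : β → ℝ) : ∑ b, g (Submodule.Quotient.mk (Pi.single b 1)) * w b =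
      g (Submodule.Quotient.mk w) := by
    have hw : w = ∑ b, w b • (Pi.single b 1 : β → ℝ) := by
      ext c
      simp [Pi.single_apply]
    conv_rhs => rw [hw, ← Submodule.mkQ_apply, map_sum, map_sum]
    refine Finset.sum_congr rfl fun b _ => ?_
    rw [map_smul, map_smul, smul_eq_mul, mul_comm, Submodule.mkQ_apply]
  refine ⟨fun b => g (Submodule.Quotient.mk (Pi.single b 1)), ?_, fun w hw => ?_, ?_⟩
  · set σ : β → ℝ := fun b => SignType.sign (g (Submodule.Quotient.mk (Pi.single b 1)))
    have hσ : ‖σ‖ ≤ 1 := by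
      refine (pi_norm_le_iff_of_nonneg zero_le_one).mpr fun b => ?_
      simp only [σ]
      rcases SignType.sign (g (Submodule.Quotient.mk (Pi.single b 1))) <;> simp
    have h := hlin σ
    simp only [σ, self_mul_sign] at h
    rw [h]
    calc _ ≤ ‖g (Submodule.Quotient.mk σ)‖ := Real.le_norm_self _
      _ ≤ ‖g‖ * ‖(Submodule.Quotient.mk σ : (β → ℝ) ⧸ W)‖ := g.le_opNorm _
      _ ≤ 1 := mul_le_one₀ hg1 (norm_nonneg _) ((Submodule.Quotient.norm_mk_le W σ).trans hσ)
  · rw [hlin, (Submodule.Quotient.mk_eq_zero W).mpr hw, map_zero]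
  · rw [hlin, hgf]
    refine le_of_forall_pos_le_add fun δ hδ => ?_
    obtain ⟨m, hm, hlt⟩ := Submodule.Quotient.norm_mk_lt
      (Submodule.Quotient.mk f : (β → ℝ) ⧸ W) hδ
    have h := hf (f - m) ((Submodule.Quotient.eq W).mp hm.symm)
    rw [sub_sub_cancel] at h
    exact h.trans hlt.le

/-- The character of `S` agrees on the cube with a polynomial of degree at most `S.card`. -/
theorem exists_polynomial_boolChar {t : ℕ} (S : Finset (Fin t)) :
    ∃ p : MvPolynomial (Fin t) ℝ, p.totalDegree ≤ S.card ∧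
      ∀ x, MvPolynomial.eval (bitPoint x) p = boolChar S x := by
  refine ⟨∏ i ∈ S, (1 - MvPolynomial.C 2 * MvPolynomial.X i), ?_, fun x => ?_⟩
  · refine (MvPolynomial.totalDegree_finsetProd _ _).trans ?_
    rw [Finset.card_eq_sum_ones]
    refine Finset.sum_le_sum fun i _ => ?_
    refine (MvPolynomial.totalDegree_sub _ _).trans (max_le (by simp) ?_)
    refine (MvPolynomial.totalDegree_mul _ _).trans ?_
    simp
  · rw [map_prod]
    refine Finset.prod_congr rfl fun i _ => ?_
    simp only [map_sub, map_one, map_mul, MvPolynomial.eval_C, MvPolynomial.eval_X, bitPoint]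
    split_ifs <;> norm_num

/-- The dual characterization of approximate degree. -/
theorem exists_dual_of_lt_approxDegree {t d : ℕ} {ε : ℝ} {f : (Fin t → Bool) → ℤˣ}
    (hd : d < approxDegree ε f) :
    ∃ ψ : (Fin t → Bool) → ℝ, ∑ b, |ψ b| ≤ 1 ∧
      (∀ S : Finset (Fin t), S.card ≤ d → ∑ b, ψ b * boolChar S b = 0) ∧
      ε ≤ ∑ b, ψ b * ((f b : ℤ) : ℝ) := by
  have hnot := Nat.notMem_of_lt_sInf hd
  simp only [Set.mem_ofPred_eq, not_exists, not_and, not_forall, not_le] at hnot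
  let ev : MvPolynomial (Fin t) ℝ →ₗ[ℝ] ((Fin t → Bool) → ℝ) :=
    LinearMap.pi fun x => (MvPolynomial.aeval (bitPoint x)).toLinearMap
  have hev (p : MvPolynomial (Fin t) ℝ) (x : Fin t → Bool) :
      ev p x = MvPolynomial.eval (bitPoint x) p := by
    simp [ev, MvPolynomial.aeval_eq_eval]
  obtain ⟨ψ, h1, horth, hf⟩ := exists_annihilating_functional
    ((MvPolynomial.restrictTotalDegree (Fin t) ℝ d).map ev) (fun b => ((f b : ℤ) : ℝ)) (ε := ε) <| by
      rintro w ⟨p, hp, rfl⟩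
      obtain ⟨x, hx⟩ := hnot p ((MvPolynomial.mem_restrictTotalDegree _ _ _).mp hp)
      refine hx.le.trans (le_trans (le_of_eq ?_)
        (norm_le_pi_norm ((fun b => ((f b : ℤ) : ℝ)) - ev p) x))
      rw [Pi.sub_apply, hev, Real.norm_eq_abs]
  refine ⟨ψ, h1, fun S hS => ?_, hf⟩
  obtain ⟨p, hp, hpe⟩ := exists_polynomial_boolChar S
  have h := horth (ev p) ⟨p, (MvPolynomial.mem_restrictTotalDegree _ _ _).mpr (hp.trans hS), rfl⟩
  simpa only [hev, hpe] using h

/-- Alice's input: each bit of `z` together with its negation. -/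
def aliceInput {t : ℕ} (z : Fin t × Bool → Bool) : Fin t × Fin 4 → Bool :=
  fun p => ![z (p.1, false), !z (p.1, false), z (p.1, true), !z (p.1, true)] p.2

/-- Bob's input: in each block, the indicator of the position selected by `V` and `w`. -/
def bobInput {t : ℕ} (V w : Fin t → Bool) : Fin t × Fin 4 → Bool :=
  fun p => ![!V p.1 && !w p.1, !V p.1 && w p.1, V p.1 && !w p.1, V p.1 && w p.1] p.2

theorem blockCompose_aliceInput_bobInput {t : ℕ} (f : (Fin t → Bool) → ℤˣ)
    (z : Fin t × Bool → Bool) (V w : Fin t → Bool) :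
    blockCompose f (aliceInput z) (bobInput V w) = f fun i => xor (z (i, V i)) (w i) := by
  unfold blockCompose
  congr 1
  funext i
  cases hV : V i <;> cases hw : w i <;> simp [aliceInput, bobInput, hV, hw]

theorem QuantumProtocol.Computes.abs_sub_le {X Y : Type*} [Fintype X] [DecidableEq X] [Fintype Y]
    [DecidableEq Y] {P : QuantumProtocol X Y} {F : X → Y → ℤˣ} {ε : ℝ} (h : P.Computes F ε)
    (x : X) (y : Y) : |((F x y : ℤ) : ℝ) - (1 - 2 * P.acceptProb x y)| ≤ 2 * ε := by
  have h1 := h x y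
  have h0 := P.acceptProb_nonneg x y
  have h2 := P.acceptProb_le_one x y
  rw [Fin.sum_univ_two] at h1
  rw [abs_le]
  rcases Int.units_eq_one_or (F x y) with hF | hF <;>
    · simp [hF, outputProb, show (1 : ℤˣ) ≠ -1 by decide, show (-1 : ℤˣ) ≠ 1 by decide] at h1 ⊢
      constructor <;> linarith

theorem sum_patternMatrix {t : ℕ} (g : (Fin t → Bool) → ℝ) :
    ∑ z : Fin t × Bool → Bool, ∑ V : Fin t → Bool, ∑ w : Fin t → Bool,
      g (fun i => xor (z (i, V i)) (w i)) = 2 ^ (3 * t) * ∑ b, g b := by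
  have h (a : Fin t → Bool) : ∑ w : Fin t → Bool, g (fun i => xor (a i) (w i)) = ∑ b, g b := by
    have hinv : Function.Involutive fun (w : Fin t → Bool) i => xor (a i) (w i) := by
      intro w
      funext i
      simp
    exact Fintype.sum_equiv hinv.toPerm _ _ fun _ => rfl
  simp only [h fun i => _, Finset.sum_const, Finset.card_univ, nsmul_eq_mul, Fintype.card_fun,
    Fintype.card_prod, Fintype.card_fin, Fintype.card_bool]
  push_cast
  ring

theorem approxDegree_lt_of_computes {t : ℕ} {f : (Fin t → Bool) → ℤˣ}
    {P : QuantumProtocol (Fin t × Fin 4 → Bool) (Fin t × Fin 4 → Bool)}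
    (hP : P.Computes (blockCompose f) (1 / 7)) :
    approxDegree (1 / 3) f < 12 + 4 * P.cost := by
  set k := P.rounds.length with hk
  rcases hD : approxDegree (1 / 3) f with _ | d
  · omega
  obtain ⟨ψ, hψ1, horth, hψf⟩ := exists_dual_of_lt_approxDegree (d := d) (by omega) (f := f)
    (ε := 1 / 3)
  obtain ⟨κ, _, A, B, hAB, hA, hB⟩ := P.exists_acceptProb_factorization
  set a := fun z (V w : Fin t → Bool) => P.acceptProb (aliceInput z) (bobInput V w) with ha
  have hcorr : (2 : ℝ) ^ (3 * t) / 21 ≤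
      2 * |∑ z, ∑ V, ∑ w, ψ (fun i => xor (z (i, V i)) (w i)) * a z V w| := by
    have h0 : ∑ b, ψ b = 0 := by simpa [boolChar] using horth ∅ (by simp)
    have hle (z V w) : ψ (fun i => xor (z (i, V i)) (w i)) *
          ((f (fun i => xor (z (i, V i)) (w i)) : ℤ) : ℝ) ≤
        ψ (fun i => xor (z (i, V i)) (w i)) -
        2 * (ψ (fun i => xor (z (i, V i)) (w i)) * a z V w) +
        2 / 7 * |ψ (fun i => xor (z (i, V i)) (w i))| := by
      have h1 := hP.abs_sub_le (aliceInput z) (bobInput V w)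
      rw [blockCompose_aliceInput_bobInput] at h1
      set q := ψ (fun i => xor (z (i, V i)) (w i))
      have h2 := le_abs_self (q * (((f (fun i => xor (z (i, V i)) (w i)) : ℤ) : ℝ) -
        (1 - 2 * a z V w)))
      rw [abs_mul] at h2
      have h3 := mul_le_mul_of_nonneg_left h1 (abs_nonneg q)
      linarith
    have hs := Finset.sum_le_sum fun z (_ : z ∈ Finset.univ) =>
      Finset.sum_le_sum fun V (_ : V ∈ Finset.univ) =>
      Finset.sum_le_sum fun w (_ : w ∈ Finset.univ) => hle z V w
    simp only [Finset.sum_add_distrib, Finset.sum_sub_distrib, ← Finset.mul_sum] at hs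
    rw [sum_patternMatrix (fun b => ψ b * ((f b : ℤ) : ℝ)), sum_patternMatrix ψ,
      sum_patternMatrix (fun b => |ψ b|), h0] at hs
    have hpos : (0 : ℝ) < 2 ^ (3 * t) := by positivity
    have h4 := mul_le_mul_of_nonneg_left hψf hpos.le
    have h5 := mul_le_mul_of_nonneg_left hψ1 hpos.le
    have h6 := neg_abs_le
      (∑ z, ∑ V, ∑ w, ψ (fun i => xor (z (i, V i)) (w i)) * a z V w)
    linarith
  set s : ℝ := √(2 ^ (d + 1)) with hs
  have hs0 : 0 < s := Real.sqrt_pos.mpr (by positivity)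
  have hupper : |∑ z, ∑ V, ∑ w, ψ (fun i => xor (z (i, V i)) (w i)) * a z V w| ≤
      2 ^ (3 * t) * 16 ^ k / s := by
    have hexp : ((∑ z, ∑ V, ∑ w, ψ (fun i => xor (z (i, V i)) (w i)) * a z V w : ℝ) : ℂ) =
        ∑ p, ∑ z, ∑ V, ∑ w, (ψ (fun i => xor (z (i, V i)) (w i)) : ℂ) *
          (A (aliceInput z) p * B (bobInput V w) p) := by
      simp only [Complex.ofReal_sum, Complex.ofReal_mul, ha, hAB, Finset.mul_sum]
      rw [Finset.sum_comm (s := (Finset.univ : Finset κ))]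
      refine Finset.sum_congr rfl fun z _ => ?_
      rw [Finset.sum_comm (s := (Finset.univ : Finset κ))]
      refine Finset.sum_congr rfl fun V _ => ?_
      rw [Finset.sum_comm (s := (Finset.univ : Finset κ))]
    rw [← Real.norm_eq_abs, ← Complex.norm_real, hexp]
    refine (norm_sum_le _ _).trans ((Finset.sum_le_sum fun p _ =>
      norm_patternMatrix_bilinear_le ψ hψ1 (fun S hS => horth S (Nat.lt_succ_iff.mp hS))
        (fun z => A (aliceInput z) p) (fun V w => B (bobInput V w) p)).trans ?_)
    rw [← Finset.mul_sum, Finset.sum_add_distrib, Finset.sum_comm]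
    have h1 : ∑ z : Fin t × Bool → Bool, ∑ p, ‖A (aliceInput z) p‖ ^ 2 ≤ 2 ^ (2 * t) * 16 ^ k := by
      refine (Finset.sum_le_sum fun z _ => hA (aliceInput z)).trans (le_of_eq ?_)
      simp [hk, mul_comm]
    have h2 : ∑ p, ∑ V : Fin t → Bool, ∑ w : Fin t → Bool, ‖B (bobInput V w) p‖ ^ 2 ≤
        2 ^ (2 * t) * 16 ^ k := by
      rw [Finset.sum_comm]
      simp_rw [Finset.sum_comm (s := (Finset.univ : Finset κ))]
      refine (Finset.sum_le_sum fun V _ => Finset.sum_le_sum fun w _ =>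
        hB (bobInput V w)).trans (le_of_eq ?_)
      simp [hk]
      ring
    calc _ ≤ 2 ^ t / (2 * s) * (2 ^ (2 * t) * 16 ^ k + 2 ^ (2 * t) * 16 ^ k) := by gcongr
      _ = _ := by
        field_simp
        ring
  have hs1 : s ≤ 42 * 16 ^ k := by
    have h := hcorr.trans (mul_le_mul_of_nonneg_left hupper zero_le_two)
    rw [← mul_div_assoc, div_le_div_iff₀ (by norm_num) hs0] at h
    have hpos : (0 : ℝ) < 2 ^ (3 * t) := by positivity
    refine le_of_mul_le_mul_left ?_ hpos
    linarith
  have hlt : (2 : ℝ) ^ (d + 1) < 2 ^ (12 + 4 * P.cost) := by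
    have h := pow_le_pow_left₀ hs0.le hs1 2
    rw [hs, Real.sq_sqrt (by positivity), mul_pow] at h
    refine h.trans_lt ?_
    have hc : (2 : ℝ) ^ (12 + 4 * P.cost) = 4096 * (16 ^ k) ^ 2 := by
      rw [QuantumProtocol.cost, ← hk, pow_add, ← pow_mul, show (16 : ℝ) = 2 ^ 4 by norm_num,
        ← pow_mul]
      norm_num
      ring_nf
    rw [hc]
    have : (0 : ℝ) < (16 ^ k) ^ 2 := by positivity
    linarith
  exact (pow_lt_pow_iff_right₀ one_lt_two).mp hlt

theorem corollary1p2 (t : ℕ) (f : (Fin t → Bool) → ℤˣ) :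
    (((1 / 4 : ℝ) * (approxDegree (1 / 3) f : ℝ) - 3 : ℝ) : EReal) <
      ((quantumCC (1 / 7) (blockCompose f) : ℕ∞) : EReal) := by
  unfold quantumCC
  set C := {c : ℕ∞ | ∃ P : QuantumProtocol (Fin t × Fin 4 → Bool) (Fin t × Fin 4 → Bool),
    P.Computes (blockCompose f) (1 / 7) ∧ (P.cost : ℕ∞) = c} with hC
  rcases C.eq_empty_or_nonempty with h | h
  · rw [h, sInf_empty]
    exact EReal.coe_lt_top _
  · obtain ⟨P, hP, hc⟩ := csInf_mem h
    rw [← hc]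
    have hlt := approxDegree_lt_of_computes hP
    have hr : (approxDegree (1 / 3) f : ℝ) < 12 + 4 * P.cost := by exact_mod_cast hlt
    have : (1 / 4 : ℝ) * (approxDegree (1 / 3) f : ℝ) - 3 < (P.cost : ℝ) := by linarith
    exact EReal.coe_lt_coe_iff.mpr this
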